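/- For every $\beta\in(0,1)$ there is a constant $c>0$, depending only on $\beta$, such that the following holds. Let $d,N$ be integers, let $V_1,\dots,V_N\in\mathbb{R}^d$, let $\lambda\in\mathbb{R}^N$ satisfy $\lambda\ge 0$ and $\sum_{j=1}^N\lambda_j=1$, let $x=\sum_{j=1}^N\lambda_jV_j$ and let $\varepsilon>0$. Let $\|\cdot\|$ be a norm on $\mathbb{R}^d$ that is $(2,D)$-smooth for some $D>0$, that is, $$\|u+v\|^2+\|u-v\|^2\le 2\|u\|^2+2D^2\|v\|^2\qquad\text{for all }u,v\in\mathbb{R}^d .$$ Put $R_v=\max_i\|\lambda_iV_i\|$, $R_\lambda=\max_i|\lambda_i|$, $R=\max\{D R_v,R_\lambda\}$ and $$s=1+N\,\frac{c(\sqrt N R/\varepsilon)^2}{1+c(\sqrt N R/\varepsilon)^2}.$$ Call a subset $J\subset\{1,\dots,N\}$ good if there are weights $\mu_j\ge 0$ $(j\in J)$ such that $\hat x=\sum_{j\in J}\mu_jV_j$ satisfies $\|x-\hat x\|\le\varepsilon$ and $\bigl|\sum_{j\in J}\mu_j-1\bigr|\le\varepsilon$. Then there is a good subset $J$ of size exactly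 $\lfloor s\rfloor$ (so of size $s$ when $s$ is an integer). Moreover, for every integer $m$ with $\lfloor s\rfloor\le m\le N$, a uniformly random $m$-element subset of $\{1,\dots,N\}$ is good with probability at least $\beta$. -/

import Mathlib

open scoped BigOperators

noncomputable section

/-- A seminorm on `ℝ^d` that is definite, that is, an arbitrary norm on `ℝ^d`. -/
def IsNorm {d : ℕ} (nrm : Seminorm ℝ (Fin d → ℝ)) : Prop :=
  ∀ v, nrm v = 0 → v = 0

/-- `(ℝ^d, nrm)` is `(2, D)`-smooth. -/
def IsTwoSmooth {d : ℕ} (nrm : Seminorm ℝ (Fin d → ℝ)) (D : ℝ) : Prop :=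
  0 < D ∧ ∀ x y : Fin d → ℝ,
    nrm (x + y) ^ 2 + nrm (x - y) ^ 2 ≤ 2 * nrm x ^ 2 + 2 * D ^ 2 * nrm y ^ 2

/-- `R_v = max_i ‖λ_i V_i‖` (the supremum is over a finite index set). -/
def radiusV {d N : ℕ} (nrm : Seminorm ℝ (Fin d → ℝ)) (lam : Fin N → ℝ)
    (V : Fin N → Fin d → ℝ) : ℝ :=
  ⨆ i, nrm (lam i • V i)

/-- `R_λ = max_i |λ_i|` (the supremum is over a finite index set). -/
def radiusLam {N : ℕ} (lam : Fin N → ℝ) : ℝ :=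
  ⨆ i, |lam i|

/-- `R = max {D R_v, R_λ}`. -/
def radius {d N : ℕ} (nrm : Seminorm ℝ (Fin d → ℝ)) (D : ℝ) (lam : Fin N → ℝ)
    (V : Fin N → Fin d → ℝ) : ℝ :=
  max (D * radiusV nrm lam V) (radiusLam lam)

/-- The real number `1 + N · c(√N R/ε)² / (1 + c(√N R/ε)²)`. -/
def sampleSize (c : ℝ) (N : ℕ) (R ε : ℝ) : ℝ :=
  1 + N * ((c * (Real.sqrt N * R / ε) ^ 2) / (1 + c * (Real.sqrt N * R / ε) ^ 2))

/-- There are nonnegative weights `μ_j`, `j ∈ J`, such that `x̂ = ∑_{j ∈ J} μ_j V_j` satisfies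
`‖x - x̂‖ ≤ ε` and `|∑_{j ∈ J} μ_j - 1| ≤ ε`. -/
def ApproxOn {d N : ℕ} (nrm : Seminorm ℝ (Fin d → ℝ)) (V : Fin N → Fin d → ℝ)
    (x : Fin d → ℝ) (ε : ℝ) (J : Finset (Fin N)) : Prop :=
  ∃ (xhat : Fin d → ℝ) (μ : J → ℝ), (∀ j, 0 ≤ μ j) ∧
    xhat = ∑ j, μ j • V j ∧ nrm (x - xhat) ≤ ε ∧ |(∑ j, μ j) - 1| ≤ ε

open Classical in
/-- The probability that a uniformly random `m`-element subset of `{1, …, N}` has property `P`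
(used for `m ≤ N` only). -/
def uniformSubsetProb (N m : ℕ) (P : Finset (Fin N) → Prop) : ℝ :=
  (((Finset.univ.powersetCard m).filter P).card : ℝ) /
    ((Finset.univ : Finset (Fin N)).powersetCard m).card

end

/-!
The subset `J` carries the weights `μ_j = (N / m) λ_j`, where `m = #J`. With the centred vectors
`y_j = λ_j V_j - x / N` one has `x̂ - x = (N / m) ∑_{j ∈ J} y_j`, and the error of the total weight
is the same expression for the centred scalars `λ_j - 1 / N`. Everything thus rests on a bound for
the mean square of `S_J = ∑_{j ∈ J} y_j` over the `m`-element sets `J`, when `∑ y_j = 0`.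

Draw the elements one by one, without replacement. If `n` indices are left outside `J`, the mean of
`y_i` over `i ∉ J` is `-S_J / n`, so that `S_J / n` is a martingale. In a `(2, D)`-smooth norm the
mean square of a martingale grows by at most `2 D²` times the mean square of its increment
(`sum_sq_add_le_of_sum_eq_zero`): the parallelogram-type inequality bounds the average of
`‖a + d‖² + ‖a - d‖²`, and Jensen's inequality gives `‖a‖²` back as a lower bound for the
average of `‖a - d‖²`. Solving the resulting recursion yields
`E ‖S_J‖² ≤ 16 D² max ‖y_i‖² m (N - m) / N` (`sum_powersetCard_sq_le`). The factor `N - m`, which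
sampling with replacement would not give, is what produces the sample size
`1 + N t / (1 + t)` rather than `1 + N t`, where
`t = c N R² / ε²`: indeed `m > N t / (1 + t)` says `(N - m) t < m`.
Chebyshev's inequality, applied to both errors with `c = 128 / (1 - β)`, concludes.
-/

/-! ### Second moments in sampling without replacement -/

/-- Double counting of the pairs `i ∈ J'`, `#J' = k + 1`, through `J = J' \ {i}`. -/
lemma sum_powersetCard_sum_compl_insert {ι : Type*} [Fintype ι] [DecidableEq ι]
    (f : Finset ι → ℝ) (k : ℕ) :
    ∑ J ∈ (Finset.univ : Finset ι).powersetCard k, ∑ i ∈ Jᶜ, f (insert i J) =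
      (k + 1) * ∑ J ∈ (Finset.univ : Finset ι).powersetCard (k + 1), f J := by
  have h : ∀ J ∈ (Finset.univ : Finset ι).powersetCard (k + 1),
      ((k : ℝ) + 1) * f J = ∑ _i ∈ J, f J := by
    intro J hJ
    rw [Finset.sum_const, (Finset.mem_powersetCard.1 hJ).2, nsmul_eq_mul]
    push_cast
    rfl
  rw [Finset.mul_sum, Finset.sum_congr rfl h, Finset.sum_sigma', Finset.sum_sigma']
  refine Finset.sum_bij' (fun p _ => ⟨insert p.2 p.1, p.2⟩) (fun p _ => ⟨p.1.erase p.2, p.2⟩)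
    ?_ ?_ ?_ ?_ ?_
  · rintro ⟨J, i⟩ hp
    simp only [Finset.mem_sigma, Finset.mem_powersetCard, Finset.subset_univ, true_and,
      Finset.mem_compl] at hp ⊢
    exact ⟨by rw [Finset.card_insert_of_notMem hp.2, hp.1], Finset.mem_insert_self _ _⟩
  · rintro ⟨J, i⟩ hp
    simp only [Finset.mem_sigma, Finset.mem_powersetCard, Finset.subset_univ, true_and,
      Finset.mem_compl] at hp ⊢
    exact ⟨by rw [Finset.card_erase_of_mem hp.2, hp.1, Nat.add_sub_cancel],
      Finset.notMem_erase _ _⟩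
  · rintro ⟨J, i⟩ hp
    simp only [Finset.mem_sigma, Finset.mem_compl] at hp
    simp [Finset.erase_insert hp.2]
  · rintro ⟨J, i⟩ hp
    simp only [Finset.mem_sigma] at hp
    simp [Finset.insert_erase hp.2]
  · rintro ⟨J, i⟩ _
    rfl

/-- One martingale step in a `(2, D)`-smooth seminorm: adding a mean-zero increment `d` to `a`
raises the mean square by at most `2 D²` times the mean square of `d`. -/
lemma sum_sq_add_le_of_sum_eq_zero {E ι : Type*} [AddCommGroup E] [Module ℝ E]
    {p : Seminorm ℝ E} {D : ℝ}
    (hp : ∀ x y, p (x + y) ^ 2 + p (x - y) ^ 2 ≤ 2 * p x ^ 2 + 2 * D ^ 2 * p y ^ 2)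
    (s : Finset ι) (a : E) (d : ι → E) (hd : ∑ i ∈ s, d i = 0) :
    ∑ i ∈ s, p (a + d i) ^ 2 ≤ s.card * p a ^ 2 + 2 * D ^ 2 * ∑ i ∈ s, p (d i) ^ 2 := by
  have h1 : ∑ i ∈ s, p (a + d i) ^ 2 + ∑ i ∈ s, p (a - d i) ^ 2 ≤
      s.card * (2 * p a ^ 2) + 2 * D ^ 2 * ∑ i ∈ s, p (d i) ^ 2 := by
    rw [← Finset.sum_add_distrib, Finset.mul_sum, ← nsmul_eq_mul, ← Finset.sum_const,
      ← Finset.sum_add_distrib]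
    exact Finset.sum_le_sum fun i _ => hp a (d i)
  have h2 : s.card * p a ≤ ∑ i ∈ s, p (a - d i) := by
    have h := Finset.le_sum_of_subadditive p (map_zero p).le (map_add_le_add p) s (fun i => a - d i)
    rwa [Finset.sum_sub_distrib, hd, sub_zero, Finset.sum_const, ← Nat.cast_smul_eq_nsmul ℝ,
      map_smul_eq_mul, Real.norm_natCast] at h
  -- Jensen's inequality for the square, through the tangent line at `p a`.
  have h3 : 2 * p a * ∑ i ∈ s, p (a - d i) - s.card * p a ^ 2 ≤ ∑ i ∈ s, p (a - d i) ^ 2 := by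
    rw [Finset.mul_sum, ← nsmul_eq_mul, ← Finset.sum_const, ← Finset.sum_sub_distrib]
    exact Finset.sum_le_sum fun i _ => by nlinarith [sq_nonneg (p a - p (a - d i))]
  nlinarith [mul_le_mul_of_nonneg_left h2 (apply_nonneg p a)]

/-- The step from `J` to `insert i J`, with `i` uniform outside `J`, for centred vectors `y`. -/
lemma sum_compl_sq_insert_le {E ι : Type*} [AddCommGroup E] [Module ℝ E] [Fintype ι]
    [DecidableEq ι] {p : Seminorm ℝ E} {D r : ℝ}
    (hp : ∀ x y, p (x + y) ^ 2 + p (x - y) ^ 2 ≤ 2 * p x ^ 2 + 2 * D ^ 2 * p y ^ 2)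
    (y : ι → E) (hy : ∑ i, y i = 0) (hr : ∀ i, p (y i) ≤ r) (J : Finset ι) {n : ℕ}
    (hJ : Jᶜ.card = n) (hn : 0 < n) :
    ∑ i ∈ Jᶜ, p (∑ j ∈ insert i J, y j) ^ 2 ≤
      n * (((n - 1) / n) ^ 2 * p (∑ j ∈ J, y j) ^ 2 + 8 * D ^ 2 * r ^ 2) := by
  have hn' : (0 : ℝ) < n := by exact_mod_cast hn
  set S := ∑ j ∈ J, y j with hS
  have hcompl : ∑ j ∈ Jᶜ, y j = -S := by
    rw [eq_neg_iff_add_eq_zero, hS, Finset.sum_compl_add_sum, hy]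
  have hd : ∑ i ∈ Jᶜ, (y i + (1 / n : ℝ) • S) = 0 := by
    rw [Finset.sum_add_distrib, hcompl, Finset.sum_const, hJ, ← Nat.cast_smul_eq_nsmul ℝ,
      smul_smul, mul_one_div_cancel hn'.ne', one_smul, neg_add_cancel]
  have hmean : p ((1 / n : ℝ) • S) ≤ r := by
    have h1 : p S ≤ n * r := by
      rw [← map_neg_eq_map p S, ← hcompl]
      refine (Finset.le_sum_of_subadditive p (map_zero p).le (map_add_le_add p) _ _).trans
        ((Finset.sum_le_sum fun i _ => hr i).trans ?_)
      rw [Finset.sum_const, hJ, nsmul_eq_mul]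
    rw [map_smul_eq_mul, Real.norm_of_nonneg (by positivity), one_div_mul_eq_div,
      div_le_iff₀ hn', mul_comm r]
    exact h1
  have hsum : ∑ i ∈ Jᶜ, p (y i + (1 / n : ℝ) • S) ^ 2 ≤ n * (4 * r ^ 2) := by
    rw [← nsmul_eq_mul, ← hJ, ← Finset.sum_const]
    refine Finset.sum_le_sum fun i _ => ?_
    have h1 : p (y i + (1 / n : ℝ) • S) ≤ 2 * r := by
      linarith [map_add_le_add p (y i) ((1 / n : ℝ) • S), hr i]
    rw [hJ]
    nlinarith [apply_nonneg p (y i + (1 / n : ℝ) • S)]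
  have hstep := sum_sq_add_le_of_sum_eq_zero hp Jᶜ (((n - 1) / n : ℝ) • S) _ hd
  have heq : ∀ i ∈ Jᶜ, p (∑ j ∈ insert i J, y j) ^ 2 =
      p (((n - 1) / n : ℝ) • S + (y i + (1 / n : ℝ) • S)) ^ 2 := by
    intro i hi
    rw [Finset.sum_insert (Finset.mem_compl.1 hi), ← hS, add_left_comm, ← add_smul]
    congr 3
    rw [← add_div, sub_add_cancel, div_self hn'.ne', one_smul]
  rw [Finset.sum_congr rfl heq]
  rw [map_smul_eq_mul, mul_pow, Real.norm_eq_abs, sq_abs, hJ] at hstep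
  nlinarith [mul_le_mul_of_nonneg_left hsum (by positivity : 0 ≤ 2 * D ^ 2)]

/-- Mean square of the sum of a random `k`-element subfamily of a centred family, in a
`(2, D)`-smooth seminorm. -/
lemma sum_powersetCard_sq_le {E ι : Type*} [AddCommGroup E] [Module ℝ E] [Fintype ι]
    [DecidableEq ι] {p : Seminorm ℝ E} {D r : ℝ}
    (hp : ∀ x y, p (x + y) ^ 2 + p (x - y) ^ 2 ≤ 2 * p x ^ 2 + 2 * D ^ 2 * p y ^ 2)
    (y : ι → E) (hy : ∑ i, y i = 0) (hr : ∀ i, p (y i) ≤ r) {k : ℕ} (hk : k ≤ Fintype.card ι) :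
    ∑ J ∈ (Finset.univ : Finset ι).powersetCard k, p (∑ j ∈ J, y j) ^ 2 ≤
      (Fintype.card ι).choose k *
        (16 * D ^ 2 * r ^ 2 * (k * (Fintype.card ι - k) / Fintype.card ι)) := by
  set N := Fintype.card ι with hN
  -- For `k = N` the sum vanishes, whereas the recursion would still add an error term.
  rcases hk.eq_or_lt with rfl | hlt
  · rw [hN, ← Finset.card_univ, Finset.powersetCard_self]
    simp [hy]
  clear hk
  induction k with
  | zero => simp
  | succ k ih =>
    have ih := ih (by omega)
    obtain ⟨n, hn⟩ : ∃ n, N = k + n := ⟨N - k, by omega⟩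
    have hn2 : 2 ≤ n := by omega
    have hn2' : (2 : ℝ) ≤ n := by exact_mod_cast hn2
    have hk0 : (0 : ℝ) ≤ k := k.cast_nonneg
    have hNR : (N : ℝ) = k + n := by exact_mod_cast hn
    have hsum := Finset.sum_le_sum fun J (hJ : J ∈ (Finset.univ : Finset ι).powersetCard k) =>
      sum_compl_sq_insert_le hp y hy hr J (n := n)
        (by rw [Finset.card_compl, (Finset.mem_powersetCard.1 hJ).2, ← hN]; omega)
        (by omega)
    rw [sum_powersetCard_sum_compl_insert (fun J => p (∑ j ∈ J, y j) ^ 2) k, ← Finset.mul_sum,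
      Finset.sum_add_distrib, ← Finset.mul_sum, Finset.sum_const, Finset.card_powersetCard,
      Finset.card_univ, ← hN, nsmul_eq_mul] at hsum
    have hchoose : (N.choose (k + 1) : ℝ) * (k + 1) = N.choose k * n := by
      have h := Nat.choose_succ_right_eq N k
      rw [show N - k = n by omega] at h
      exact_mod_cast h
    -- This is where the bound on `k (N - k) / N` is checked against the recursion. The difference
    -- of the two sides is `8 (n - 2) / n`, hence the restriction to `k + 1 < N`.
    have hrec : ((n - 1) / n : ℝ) ^ 2 * (16 * (k * (N - k) / N)) + 8 ≤
        16 * (((k + 1 : ℕ) : ℝ) * (N - (k + 1 : ℕ)) / N) := by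
      rw [hNR]
      push_cast
      have e : 16 * (((k : ℝ) + 1) * (k + n - (k + 1)) / (k + n)) -
          (((n - 1) / n : ℝ) ^ 2 * (16 * (k * (k + n - k) / (k + n))) + 8) =
          8 * (n - 2) / n := by
        field_simp
        ring
      have h0 : (0 : ℝ) ≤ 8 * (n - 2) / n := div_nonneg (by linarith) (by linarith)
      linarith
    have hk1 : (0 : ℝ) < k + 1 := by positivity
    refine le_of_mul_le_mul_left ?_ hk1
    refine hsum.trans ?_
    calc (n : ℝ) * (((n - 1) / n) ^ 2 * ∑ J ∈ Finset.univ.powersetCard k, p (∑ j ∈ J, y j) ^ 2 +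
          N.choose k * (8 * D ^ 2 * r ^ 2))
        ≤ n * (((n - 1) / n) ^ 2 * (N.choose k * (16 * D ^ 2 * r ^ 2 * (k * (N - k) / N))) +
          N.choose k * (8 * D ^ 2 * r ^ 2)) := by gcongr
      _ = (N.choose k * n) * (D ^ 2 * r ^ 2) *
          (((n - 1) / n : ℝ) ^ 2 * (16 * (k * (N - k) / N)) + 8) := by ring
      _ ≤ (N.choose k * n) * (D ^ 2 * r ^ 2) *
          (16 * (((k + 1 : ℕ) : ℝ) * (N - (k + 1 : ℕ)) / N)) := by gcongr
      _ = _ := by rw [← hchoose]; ring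

/-- Second moment of the error of the rescaled partial sum `(N / m) ∑_{j ∈ J} z_j` as an estimate
of the full sum. -/
lemma sum_powersetCard_sq_error_le {E : Type*} [AddCommGroup E] [Module ℝ E] {N m : ℕ}
    {p : Seminorm ℝ E} {D r : ℝ}
    (hp : ∀ x y, p (x + y) ^ 2 + p (x - y) ^ 2 ≤ 2 * p x ^ 2 + 2 * D ^ 2 * p y ^ 2)
    (z : Fin N → E) (hr : ∀ i, p (z i) ≤ r) (hm : 0 < m) (hmN : m ≤ N) :
    ∑ J ∈ (Finset.univ : Finset (Fin N)).powersetCard m,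
        p (∑ j, z j - ∑ j ∈ J, (N / m : ℝ) • z j) ^ 2 ≤
      N.choose m * (64 * (D * r) ^ 2 * (N * (N - m) / m)) := by
  have hm' : (0 : ℝ) < m := by exact_mod_cast hm
  have hN' : (0 : ℝ) < N := by exact_mod_cast hm.trans_le hmN
  set x := ∑ j, z j with hx
  have hy : ∑ i, (z i - (1 / N : ℝ) • x) = 0 := by
    rw [Finset.sum_sub_distrib, Finset.sum_const, Finset.card_univ, Fintype.card_fin,
      ← Nat.cast_smul_eq_nsmul ℝ, smul_smul, mul_one_div_cancel hN'.ne', one_smul, sub_self]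
  have hmean : p ((1 / N : ℝ) • x) ≤ r := by
    have h1 : p x ≤ N * r := by
      refine (Finset.le_sum_of_subadditive p (map_zero p).le (map_add_le_add p) _ _).trans
        ((Finset.sum_le_sum fun i _ => hr i).trans ?_)
      rw [Finset.sum_const, Finset.card_univ, Fintype.card_fin, nsmul_eq_mul]
    rw [map_smul_eq_mul, Real.norm_of_nonneg (by positivity), one_div_mul_eq_div,
      div_le_iff₀ hN', mul_comm r]
    exact h1
  have hr2 : ∀ i, p (z i - (1 / N : ℝ) • x) ≤ 2 * r := fun i => by
    linarith [map_sub_le_add p (z i) ((1 / N : ℝ) • x), hr i]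
  have h := sum_powersetCard_sq_le hp _ hy hr2 (k := m) (by rwa [Fintype.card_fin])
  rw [Fintype.card_fin] at h
  have heq : ∀ J ∈ (Finset.univ : Finset (Fin N)).powersetCard m,
      p (x - ∑ j ∈ J, (N / m : ℝ) • z j) ^ 2 =
        (N / m : ℝ) ^ 2 * p (∑ j ∈ J, (z j - (1 / N : ℝ) • x)) ^ 2 := by
    intro J hJ
    have h1 : x - ∑ j ∈ J, (N / m : ℝ) • z j =
        -((N / m : ℝ) • ∑ j ∈ J, (z j - (1 / N : ℝ) • x)) := by
      rw [Finset.sum_sub_distrib, Finset.sum_const, (Finset.mem_powersetCard.1 hJ).2,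
        ← Nat.cast_smul_eq_nsmul ℝ, smul_smul, smul_sub, smul_smul, ← Finset.smul_sum, neg_sub,
        show (N / m : ℝ) * (m * (1 / N)) = 1 by field_simp, one_smul]
    rw [h1, map_neg_eq_map, map_smul_eq_mul, Real.norm_of_nonneg (by positivity), mul_pow]
  rw [Finset.sum_congr rfl heq, ← Finset.mul_sum]
  refine (mul_le_mul_of_nonneg_left h (by positivity)).trans (le_of_eq ?_)
  field_simp
  ring

/-- The absolute value on `ℝ` is `(2, 1)`-smooth, by the parallelogram identity. -/
lemma normSeminorm_real_two_smooth (x y : ℝ) :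
    normSeminorm ℝ ℝ (x + y) ^ 2 + normSeminorm ℝ ℝ (x - y) ^ 2 ≤
      2 * normSeminorm ℝ ℝ x ^ 2 + 2 * 1 ^ 2 * normSeminorm ℝ ℝ y ^ 2 := by
  simp only [coe_normSeminorm, Real.norm_eq_abs, sq_abs]
  exact le_of_eq (by ring)

/-! ### Sample size and probability of success -/

/-- The rescaled weights `(N / m) λ_j` witness `ApproxOn` whenever both errors are small. -/
lemma approxOn_of_rescaled {d N : ℕ} {nrm : Seminorm ℝ (Fin d → ℝ)} {V : Fin N → Fin d → ℝ}
    {lam : Fin N → ℝ} (hlam : ∀ j, 0 ≤ lam j) {x : Fin d → ℝ} {ε q : ℝ} (hq : 0 ≤ q)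
    {J : Finset (Fin N)} (h1 : nrm (x - ∑ j ∈ J, q • lam j • V j) ≤ ε)
    (h2 : |1 - ∑ j ∈ J, q • lam j| ≤ ε) : ApproxOn nrm V x ε J := by
  refine ⟨∑ j ∈ J, q • lam j • V j, fun j => q • lam j, fun j => mul_nonneg hq (hlam j),
    ?_, h1, ?_⟩
  · rw [← Finset.sum_coe_sort J]
    exact Finset.sum_congr rfl fun j _ => (smul_assoc _ _ _).symm
  · rw [Finset.sum_coe_sort J (fun j => q • lam j), abs_sub_comm]
    exact h2

/-- The sample size is chosen so that `c N R² (N - m) / m ≤ ε²`. -/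
lemma mul_sub_div_le_of_floor_sampleSize_le {c R ε : ℝ} {N m : ℕ} (hc : 0 < c) (hε : 0 < ε)
    (h : ⌊sampleSize c N R ε⌋₊ ≤ m) :
    0 < m ∧ R ^ 2 * (N * (N - m) / m) ≤ ε ^ 2 / c := by
  have hA : (Real.sqrt N * R / ε) ^ 2 = N * R ^ 2 / ε ^ 2 := by
    rw [div_pow, mul_pow, Real.sq_sqrt N.cast_nonneg]
  unfold sampleSize at h
  rw [hA] at h
  set t := c * (N * R ^ 2 / ε ^ 2) with ht
  have ht0 : 0 ≤ t := by positivity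
  have hm1 : 1 ≤ m := le_trans (Nat.le_floor (by
    rw [Nat.cast_one]
    exact le_add_of_nonneg_right (by positivity))) h
  have hm0 : (0 : ℝ) < m := by exact_mod_cast hm1
  have hlt : N * (t / (1 + t)) < m := by
    have h1 := Nat.lt_floor_add_one (1 + N * (t / (1 + t)))
    have h2 : ((⌊1 + N * (t / (1 + t))⌋₊ : ℕ) : ℝ) ≤ m := by exact_mod_cast h
    linarith
  rw [← mul_div_assoc, div_lt_iff₀ (by positivity)] at hlt
  refine ⟨hm1, ?_⟩
  have h3 : (N - m) * t ≤ m := by linarith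
  have h4 : R ^ 2 * (N * (N - m) / m) = ((N - m) * t / m) * (ε ^ 2 / c) := by
    rw [ht]
    field_simp
  rw [h4]
  exact mul_le_of_le_one_left (by positivity) ((div_le_one hm0).2 h3)

lemma floor_sampleSize_le {c R ε : ℝ} {N : ℕ} (hc : 0 < c) (hN : 0 < N) :
    ⌊sampleSize c N R ε⌋₊ ≤ N := by
  unfold sampleSize
  set t := c * (Real.sqrt N * R / ε) ^ 2 with ht
  have ht0 : 0 ≤ t := by positivity
  have hN' : (0 : ℝ) < N := by exact_mod_cast hN
  have h1 : t / (1 + t) < 1 := (div_lt_one (by positivity)).2 (by linarith)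
  refine Nat.lt_succ_iff.1 ((Nat.floor_lt (by positivity)).2 ?_)
  push_cast
  nlinarith

/-- Chebyshev's inequality in the form of a count: if two statistics have mean squares
at most `δ ε²`, then at least the fraction `1 - 2 δ` of the sets has both at most `ε`. -/
lemma le_uniformSubsetProb_of_sum_sq_le {N m : ℕ} (hmN : m ≤ N) {P : Finset (Fin N) → Prop}
    {f g : Finset (Fin N) → ℝ} {ε δ : ℝ} (hε : 0 < ε)
    (hf : ∑ J ∈ (Finset.univ : Finset (Fin N)).powersetCard m, f J ^ 2 ≤
      N.choose m * (δ * ε ^ 2))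
    (hg : ∑ J ∈ (Finset.univ : Finset (Fin N)).powersetCard m, g J ^ 2 ≤
      N.choose m * (δ * ε ^ 2))
    (hP : ∀ J ∈ (Finset.univ : Finset (Fin N)).powersetCard m, f J ≤ ε → g J ≤ ε → P J) :
    1 - 2 * δ ≤ uniformSubsetProb N m P := by
  classical
  have hcard : ((Finset.univ : Finset (Fin N)).powersetCard m).card = N.choose m := by simp
  have hpos : (0 : ℝ) < N.choose m := by exact_mod_cast Nat.choose_pos hmN
  unfold uniformSubsetProb
  rw [hcard, le_div_iff₀ hpos]
  have h1 : ∑ J ∈ (Finset.univ : Finset (Fin N)).powersetCard m, ε ^ 2 ≤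
      ∑ J ∈ (Finset.univ : Finset (Fin N)).powersetCard m,
        ((if P J then 1 else 0) * ε ^ 2 + f J ^ 2 + g J ^ 2) := by
    refine Finset.sum_le_sum fun J hJ => ?_
    by_cases hPJ : P J
    · rw [if_pos hPJ]
      nlinarith [sq_nonneg (f J), sq_nonneg (g J)]
    · rw [if_neg hPJ]
      rcases le_or_gt (f J) ε with h | h
      · have h' : ε < g J := lt_of_not_ge fun h' => hPJ (hP J hJ h h')
        nlinarith [sq_nonneg (f J)]
      · nlinarith [sq_nonneg (g J)]
  rw [Finset.sum_add_distrib, Finset.sum_add_distrib, ← Finset.sum_mul, Finset.sum_boole,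
    Finset.sum_const, hcard, nsmul_eq_mul] at h1
  refine le_of_mul_le_mul_right ?_ (by positivity : 0 < ε ^ 2)
  have h2 : (1 - 2 * δ) * N.choose m * ε ^ 2 =
      N.choose m * ε ^ 2 - 2 * (N.choose m * (δ * ε ^ 2)) := by ring
  rw [h2]
  have h3 : (N.choose m : ℝ) * ε ^ 2 - 2 * (N.choose m * (δ * ε ^ 2)) ≤
      (((Finset.univ.powersetCard m).filter P).card : ℝ) * ε ^ 2 := by linarith
  convert h3

theorem mainTheorem3 (β : ℝ) (hβ : 0 < β) (hβ1 : β < 1) :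
    ∃ c : ℝ, 0 < c ∧
      ∀ (d N : ℕ) (V : Fin N → Fin d → ℝ) (lam : Fin N → ℝ) (x : Fin d → ℝ)
        (nrm : Seminorm ℝ (Fin d → ℝ)) (D ε : ℝ),
        IsNorm nrm → IsTwoSmooth nrm D →
        (∀ j, 0 ≤ lam j) → ∑ j, lam j = 1 → x = ∑ j, lam j • V j → 0 < ε →
        (∃ J : Finset (Fin N),
          J.card = ⌊sampleSize c N (radius nrm D lam V) ε⌋₊ ∧ ApproxOn nrm V x ε J) ∧
        (∀ m : ℕ, ⌊sampleSize c N (radius nrm D lam V) ε⌋₊ ≤ m → m ≤ N →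
          β ≤ uniformSubsetProb N m (ApproxOn nrm V x ε)) := by
  have hc : 0 < 128 / (1 - β) := div_pos (by norm_num) (by linarith)
  refine ⟨128 / (1 - β), hc, ?_⟩
  intro d N V lam x nrm D ε _ hD hlam hsum hx hε
  have hN : 0 < N := by
    rcases N.eq_zero_or_pos with rfl | h
    · simp at hsum
    · exact h
  set R := radius nrm D lam V with hR
  have hprob : ∀ m : ℕ, ⌊sampleSize (128 / (1 - β)) N R ε⌋₊ ≤ m → m ≤ N →
      β ≤ uniformSubsetProb N m (ApproxOn nrm V x ε) := by
    intro m hm hmN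
    obtain ⟨hm0, hmR⟩ := mul_sub_div_le_of_floor_sampleSize_le hc hε hm
    have hm0' : (0 : ℝ) < m := by exact_mod_cast hm0
    have hmN' : (0 : ℝ) ≤ N - m := sub_nonneg.2 (by exact_mod_cast hmN)
    have hV : ∀ i, nrm (lam i • V i) ≤ radiusV nrm lam V :=
      fun i => le_ciSup (f := fun i => nrm (lam i • V i)) (Set.finite_range _).bddAbove i
    have hL : ∀ i, normSeminorm ℝ ℝ (lam i) ≤ radiusLam lam :=
      fun i => le_ciSup (f := fun i => |lam i|) (Set.finite_range _).bddAbove i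
    have hbound : ∀ ρ : ℝ, 0 ≤ ρ → ρ ≤ R →
        (N.choose m : ℝ) * (64 * ρ ^ 2 * (N * (N - m) / m)) ≤
          N.choose m * ((1 - β) / 2 * ε ^ 2) := by
      intro ρ hρ hρR
      refine mul_le_mul_of_nonneg_left ?_ (Nat.cast_nonneg _)
      calc 64 * ρ ^ 2 * (N * (N - m) / m) ≤ 64 * R ^ 2 * (N * (N - m) / m) := by gcongr
        _ = 64 * (R ^ 2 * (N * (N - m) / m)) := by ring
        _ ≤ 64 * (ε ^ 2 / (128 / (1 - β))) := by gcongr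
        _ = _ := by
          have : 1 - β ≠ 0 := by linarith
          field_simp
          ring
    have hf := (sum_powersetCard_sq_error_le hD.2 (fun j => lam j • V j) hV hm0 hmN).trans
      (hbound _ (mul_nonneg hD.1.le ((apply_nonneg nrm _).trans (hV ⟨0, hN⟩)))
        (le_max_left _ _))
    have hg := (sum_powersetCard_sq_error_le normSeminorm_real_two_smooth lam hL hm0 hmN).trans
      (hbound _ (by rw [one_mul]; exact (apply_nonneg _ _).trans (hL ⟨0, hN⟩))
        (by rw [one_mul]; exact le_max_right _ _))
    rw [← hx] at hf
    rw [hsum] at hg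
    have h := le_uniformSubsetProb_of_sum_sq_le hmN (P := ApproxOn nrm V x ε) hε hf hg
      fun J _ h1 h2 => approxOn_of_rescaled hlam (by positivity) h1 h2
    linarith
  refine ⟨?_, hprob⟩
  -- A set of positive probability is not empty.
  have hpos := hβ.trans_le (hprob _ le_rfl (floor_sampleSize_le hc hN))
  classical
  by_contra! hne
  refine hpos.ne' ?_
  unfold uniformSubsetProb
  rw [Finset.filter_false_of_mem fun J hJ => hne J (Finset.mem_powersetCard.1 hJ).2]
  simp
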